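/- Let $\mathbb{H}^3=\{(x_1,x_2,x_3)\in\mathbb{R}^3 : x_3>0\}$ carry the hyperbolic metric $x_3^{-2}(dx_1^2+dx_2^2+dx_3^2)$. A complete end of revolution in $\mathbb{H}^3$ is a map $F:[0,\infty)\times\mathbb{S}^1\to\mathbb{H}^3$ of the form $$F(t,\theta)=\Phi\big(\gamma_1(t)\cos\theta,\ \gamma_1(t)\sin\theta,\ \gamma_2(t)\big),$$ where $\Phi$ is an isometry of $\mathbb{H}^3$ (so that the axis, the image under $\Phi$ of the $x_3$-axis, is an arbitrary geodesic) and $\gamma=(\gamma_1,0,\gamma_2):[0,\infty)\to\mathbb{H}^3$ is a smooth regular curve with $\gamma_1>0$ and with infinite hyperbolic length; the end $E$ is the image of $F$, regarded as an immersed surface with boundary $\{0\}\times\mathbb{S}^1$ and with the metric induced by $F$. For $c>0$ the $c$-cone is the surface obtained by rotating the ray $\{(t,0,ct) : t>0\}$ about the $x_3$-axis; $E$ is contained on the $c$-cone if it lies on or above it, that is, if $x_3\ge c\sqrt{x_1^2+x_2^2}$ at every point of $E$ (when $\Phi$ is the identity, this says that $\gamma_2/\gamma_1\ge c$). Theorem.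 Let $E$ be a complete end of revolution in $\mathbb{H}^3$ that is contained on the $c$-cone for some $c>0$. Then $E$ is parabolic: every bounded harmonic function on $E$ is determined by its boundary values. That is, if $u$ and $v$ are bounded continuous functions on $[0,\infty)\times\mathbb{S}^1$ that are $C^2$ and harmonic for the induced metric on $(0,\infty)\times\mathbb{S}^1$, and $u=v$ on $\{0\}\times\mathbb{S}^1$, then $u=v$ on $[0,\infty)\times\mathbb{S}^1$. -/

import Mathlib

open Set MeasureTheory

noncomputable section

namespace HypRev

/-- The ambient coordinate space with coordinates `(x₁, x₂, x₃) = (x 0, x 1, x 2)`. -/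
abbrev Space3 : Type := EuclideanSpace ℝ (Fin 3)

/-- The upper half-space `x₃ > 0`, the underlying set of hyperbolic 3-space. -/
def upperHalfSpace : Set Space3 := {x | 0 < x 2}

/-- The hyperbolic metric `(dx₁² + dx₂² + dx₃²) / x₃²` at the point `x`. -/
def hypMetric (x u v : Space3) : ℝ := inner ℝ u v / (x 2) ^ 2

/-- The hyperbolic distance in the upper half-space (same formula as Mathlib's distance on
`UpperHalfPlane`). -/
def hypDist (x y : Space3) : ℝ := 2 * Real.arsinh (dist x y / (2 * √(x 2 * y 2)))

/-- Isometries of hyperbolic 3-space: bijections of the upper half-space that preserve the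
hyperbolic distance. Such maps are automatically smooth; smoothness is recorded for convenience. -/
structure IsHypIsometry (Φ : Space3 → Space3) : Prop where
  bijOn : BijOn Φ upperHalfSpace upperHalfSpace
  contDiffOn : ContDiffOn ℝ (⊤ : ℕ∞) Φ upperHalfSpace
  dist_eq : ∀ x ∈ upperHalfSpace, ∀ y ∈ upperHalfSpace, hypDist (Φ x) (Φ y) = hypDist x y

/-- The point `(r cos θ, r sin θ, z)`: the image of `(r, 0, z)` under the rotation of angle `θ`
about the `x₃`-axis. -/
def rotPoint (r z : ℝ) (θ : Real.Angle) : Space3 := !₂[r * θ.cos, r * θ.sin, z]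

/-- The vector `(a, 0, b)` in the `(x₁, x₃)`-plane. -/
def planeVec (a b : ℝ) : Space3 := !₂[a, 0, b]

/-- `t ↦ (γ₁ t, 0, γ₂ t)`, `t ∈ [0, ∞)`, is a smooth regular curve in the totally geodesic
half-plane `{(x₁, 0, x₃) : x₁ > 0, x₃ > 0}` bounded by the `x₃`-axis, with infinite hyperbolic
length. No normalization of the parameter is imposed. -/
structure IsCompleteProfile (γ₁ γ₂ : ℝ → ℝ) : Prop where
  smooth₁ : ContDiffOn ℝ (⊤ : ℕ∞) γ₁ (Ici 0)
  smooth₂ : ContDiffOn ℝ (⊤ : ℕ∞) γ₂ (Ici 0)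
  pos₁ : ∀ t, 0 ≤ t → 0 < γ₁ t
  pos₂ : ∀ t, 0 ≤ t → 0 < γ₂ t
  regular : ∀ t, 0 ≤ t → planeVec (derivWithin γ₁ (Ici 0) t) (derivWithin γ₂ (Ici 0) t) ≠ 0
  length_eq_top :
    ∫⁻ t in Ici (0 : ℝ), ENNReal.ofReal
      (√(hypMetric (planeVec (γ₁ t) (γ₂ t))
        (planeVec (derivWithin γ₁ (Ici 0) t) (derivWithin γ₂ (Ici 0) t))
        (planeVec (derivWithin γ₁ (Ici 0) t) (derivWithin γ₂ (Ici 0) t)))) = ⊤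

/-- The half-cylinder `[0, ∞) × S¹`, with `S¹ = ℝ / 2πℤ`. -/
def halfCylinder : Set (ℝ × Real.Angle) := {p | 0 ≤ p.1}

/-- `F`, restricted to `[0, ∞) × S¹`, is a complete end of revolution in hyperbolic 3-space.
Up to an isometry `Φ` the axis is the `x₃`-axis, so the axis `Φ (x₃-axis)` is an arbitrary
geodesic and the generating curve `Φ ∘ γ` lies in an arbitrary totally geodesic half-plane
bounded by it. The end may have self-intersections. -/
def IsCompleteEndOfRevolution (F : ℝ × Real.Angle → Space3) : Prop :=
  ∃ (Φ : Space3 → Space3) (γ₁ γ₂ : ℝ → ℝ), IsHypIsometry Φ ∧ IsCompleteProfile γ₁ γ₂ ∧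
    ∀ t, 0 ≤ t → ∀ θ : Real.Angle, F (t, θ) = Φ (rotPoint (γ₁ t) (γ₂ t) θ)

/-- The `c`-cone: the rotation about the `x₃`-axis of the ray `t ↦ (t, 0, c t)`, `t > 0`. -/
def cCone (c : ℝ) : Set Space3 := {x | ∃ t : ℝ, 0 < t ∧ ∃ θ : Real.Angle, x = rotPoint t (c * t) θ}

/-- The part of hyperbolic space on or above the `c`-cone: no point of the cone lies strictly
above `x` on the vertical line through `x`. -/
def aboveCCone (c : ℝ) : Set Space3 :=
  {x ∈ upperHalfSpace | ∀ y ∈ cCone c, y 0 = x 0 → y 1 = x 1 → y 2 ≤ x 2}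

/-- The expression of a function on `ℝ × S¹` in the coordinates `(t, θ) ∈ ℝ × ℝ`. -/
def lift {X : Type*} (f : ℝ × Real.Angle → X) (p : ℝ × ℝ) : X := f (p.1, (p.2 : Real.Angle))

/-- The coordinate vectors of `ℝ × ℝ`. -/
def coordVec (i : Fin 2) : ℝ × ℝ := ![((1 : ℝ), (0 : ℝ)), ((0 : ℝ), (1 : ℝ))] i

/-- The partial derivative in the `i`-th coordinate. -/
def pderiv {X : Type*} [NormedAddCommGroup X] [NormedSpace ℝ X] (i : Fin 2) (f : ℝ × ℝ → X)
    (p : ℝ × ℝ) : X := fderiv ℝ f p (coordVec i)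

/-- The matrix of the pull-back of the hyperbolic metric by a parametrized surface `f`. -/
def inducedMetric (f : ℝ × ℝ → Space3) (p : ℝ × ℝ) : Matrix (Fin 2) (Fin 2) ℝ :=
  Matrix.of fun i j => hypMetric (f p) (pderiv i f p) (pderiv j f p)

/-- The Laplace–Beltrami operator of a metric `g` in coordinates:
`Δ u = (det g)^(-1/2) ∑ᵢ ∂ᵢ ((det g)^(1/2) ∑ⱼ gⁱʲ ∂ⱼ u)`. -/
def laplaceBeltrami (g : ℝ × ℝ → Matrix (Fin 2) (Fin 2) ℝ) (u : ℝ × ℝ → ℝ) (p : ℝ × ℝ) : ℝ :=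
  (√((g p).det))⁻¹ *
    ∑ i, pderiv i (fun q => √((g q).det) * ∑ j, (g q)⁻¹ i j * pderiv j u q) p

/-- `u` is a bounded harmonic function on the surface with boundary `F : [0, ∞) × S¹ → ℍ³`,
equipped with the induced metric: bounded and continuous up to the boundary, `C²` and harmonic in
the interior. -/
structure IsBoundedHarmonic (F : ℝ × Real.Angle → Space3) (u : ℝ × Real.Angle → ℝ) : Prop where
  continuousOn : ContinuousOn u halfCylinder
  bounded : ∃ M : ℝ, ∀ p ∈ halfCylinder, |u p| ≤ M
  contDiffOn : ContDiffOn ℝ 2 (lift u) {p : ℝ × ℝ | 0 < p.1}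
  harmonic : ∀ p : ℝ × ℝ, 0 < p.1 → laplaceBeltrami (inducedMetric (lift F)) (lift u) p = 0

/-- The end is parabolic: every bounded harmonic function on it is determined by its values on the
boundary `{0} × S¹`. -/
def IsParabolicEnd (F : ℝ × Real.Angle → Space3) : Prop :=
  ∀ u v : ℝ × Real.Angle → ℝ, IsBoundedHarmonic F u → IsBoundedHarmonic F v →
    (∀ θ : Real.Angle, u (0, θ) = v (0, θ)) → ∀ p ∈ halfCylinder, u p = v p

end HypRev

end

/-!
Write `r = γ₁`, `z = γ₂`. The induced metric is `(|γ'|² dt² + r² dθ²) / z²`, because the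
differential of an isometry preserves the metric tensor (`IsHypIsometry.hypMetric_eq`). It is
conformal to the flat metric `ds² + dθ²` with `s(t) = ∫₀ᵗ |γ'| / r`, so in dimension two its
harmonic functions are those of a flat half-cylinder of length `s(∞)`
(`IsBoundedHarmonic.exists_hasDerivAt`).

The length is infinite: hyperbolic arc length is `(r / z) ds`, it is infinite by completeness, and
`r / z` is bounded (`IsCompleteProfile.exists_lt_isoCoord`). The bound on `r / z` is where the cone
enters. If the isometry `Φ` moves the axis, it does not preserve the cone, but no knowledge of the
form of `Φ` is needed: the region above the cone is a tube about a geodesic, so three of its points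
behave, up to a bounded error, like three points of a line, and cannot be pairwise equidistant
unless they are close together (`equilateral_bound`). Applied to three points at angles `2π/3` on
an orbit circle, this bounds the radius of the circle (`exists_orbit_bound`).

On an infinite flat half-cylinder the difference `u - v` of two bounded harmonic functions with the
same boundary values is compared with `ε log (1 + s)`, which tends to infinity and is strictly
superharmonic. Hence `u - v - ε log (1 + s)` has no interior maximum and is nonpositive
(`IsCompleteProfile.sub_le_log`); then `ε → 0`.
-/

noncomputable section

namespace HypRev

open Filter Topology

/-! ### Isometries preserve the metric tensor -/

theorem IsHypIsometry.pos {Φ : Space3 → Space3} (hΦ : IsHypIsometry Φ) {x : Space3}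
    (hx : 0 < x 2) : 0 < Φ x 2 := hΦ.bijOn.mapsTo hx

/-- An isometry preserves `|x - y|² / (x₃ y₃) = 4 sinh² (d(x, y) / 2)`; this is the only form in
which the hyperbolic distance is used. -/
theorem IsHypIsometry.dist_sq_div {Φ : Space3 → Space3} (hΦ : IsHypIsometry Φ) {x y : Space3}
    (hx : 0 < x 2) (hy : 0 < y 2) :
    dist (Φ x) (Φ y) ^ 2 / (Φ x 2 * Φ y 2) = dist x y ^ 2 / (x 2 * y 2) := by
  have h := hΦ.dist_eq x hx y hy
  unfold hypDist at h
  have h1 := Real.arsinh_injective (mul_left_cancel₀ (two_ne_zero) h)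
  have h2 := congrArg (fun r => 4 * r ^ 2) h1
  simp only [div_pow, mul_pow] at h2
  rw [Real.sq_sqrt (mul_pos hx hy).le,
    Real.sq_sqrt (mul_pos (hΦ.pos hx) (hΦ.pos hy)).le] at h2
  have := mul_pos hx hy
  have := mul_pos (hΦ.pos hx) (hΦ.pos hy)
  field_simp at h2 ⊢
  linarith

theorem isOpen_upperHalfSpace : IsOpen upperHalfSpace :=
  isOpen_lt continuous_const (by fun_prop)

theorem IsHypIsometry.differentiableAt {Φ : Space3 → Space3} (hΦ : IsHypIsometry Φ) {x : Space3}
    (hx : 0 < x 2) : DifferentiableAt ℝ Φ x :=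
  (hΦ.contDiffOn.contDiffAt (isOpen_upperHalfSpace.mem_nhds hx)).differentiableAt (by simp)

/-- The differential of an isometry preserves the hyperbolic length of a vector. This is obtained
by dividing `IsHypIsometry.dist_sq_div` for the points `x + s u` and `x` by `s²` and letting
`s → 0`. -/
theorem IsHypIsometry.hypMetric_self {Φ : Space3 → Space3} (hΦ : IsHypIsometry Φ) {x : Space3}
    (hx : 0 < x 2) (u : Space3) :
    hypMetric (Φ x) (fderiv ℝ Φ x u) (fderiv ℝ Φ x u) = hypMetric x u u := by
  have hline : HasDerivAt (fun s : ℝ => x + s • u) u 0 := by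
    simpa using ((hasDerivAt_id (0 : ℝ)).smul_const u).const_add x
  have hd : HasDerivAt (fun s : ℝ => Φ (x + s • u)) (fderiv ℝ Φ x u) 0 := by
    have h0 : HasFDerivAt Φ (fderiv ℝ Φ x) (x + (0 : ℝ) • u) := by
      simpa using (hΦ.differentiableAt hx).hasFDerivAt
    exact h0.comp_hasDerivAt (0 : ℝ) hline
  have hc1 : Tendsto (fun s : ℝ => (x + s • u) 2) (𝓝[≠] 0) (𝓝 (x 2)) := by
    have : Continuous fun s : ℝ => (x + s • u) 2 := by fun_prop
    simpa using (this.tendsto 0).mono_left nhdsWithin_le_nhds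
  have hc2 : Tendsto (fun s : ℝ => Φ (x + s • u) 2) (𝓝[≠] 0) (𝓝 (Φ x 2)) := by
    have h1 : Continuous fun y : Space3 => y 2 := by fun_prop
    have := (h1.continuousAt.comp hd.continuousAt).tendsto
    simpa [Function.comp_def] using this.mono_left nhdsWithin_le_nhds
  have hslope := hd.tendsto_slope
  have hL : Tendsto (fun s : ℝ => ‖slope (fun s : ℝ => Φ (x + s • u)) 0 s‖ ^ 2 /
      (Φ (x + s • u) 2 * Φ x 2)) (𝓝[≠] 0) (𝓝 (‖fderiv ℝ Φ x u‖ ^ 2 / (Φ x 2 * Φ x 2))) :=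
    (hslope.norm.pow 2).div (hc2.mul_const _) (mul_pos (hΦ.pos hx) (hΦ.pos hx)).ne'
  have hR : Tendsto (fun s : ℝ => ‖u‖ ^ 2 / ((x + s • u) 2 * x 2)) (𝓝[≠] 0)
      (𝓝 (‖u‖ ^ 2 / (x 2 * x 2))) :=
    tendsto_const_nhds.div (hc1.mul_const _) (mul_pos hx hx).ne'
  have heq : (fun s : ℝ => ‖slope (fun s : ℝ => Φ (x + s • u)) 0 s‖ ^ 2 /
      (Φ (x + s • u) 2 * Φ x 2)) =ᶠ[𝓝[≠] 0] fun s : ℝ => ‖u‖ ^ 2 / ((x + s • u) 2 * x 2) := by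
    filter_upwards [hc1.eventually (lt_mem_nhds hx), self_mem_nhdsWithin] with s hs hs0
    have hs0 : s ≠ 0 := hs0
    have h := hΦ.dist_sq_div hs hx
    have e : dist (x + s • u) x = |s| * ‖u‖ := by simp [dist_eq_norm, norm_smul]
    rw [e, dist_eq_norm, mul_pow, sq_abs] at h
    simp only [slope_def_module, sub_zero, zero_smul, add_zero, norm_smul, norm_inv,
      Real.norm_eq_abs, mul_pow, inv_pow, sq_abs]
    rw [mul_div_assoc, h]
    field_simp
  have := tendsto_nhds_unique hL (hR.congr' heq.symm)
  simpa [hypMetric, real_inner_self_eq_norm_sq, sq] using this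

/-- The differential of an isometry preserves the hyperbolic metric. -/
theorem IsHypIsometry.hypMetric_eq {Φ : Space3 → Space3} (hΦ : IsHypIsometry Φ) {x : Space3}
    (hx : 0 < x 2) (u v : Space3) :
    hypMetric (Φ x) (fderiv ℝ Φ x u) (fderiv ℝ Φ x v) = hypMetric x u v := by
  have h1 := hΦ.hypMetric_self hx (u + v)
  have h2 := hΦ.hypMetric_self hx u
  have h3 := hΦ.hypMetric_self hx v
  simp only [hypMetric, map_add, inner_add_left, inner_add_right, add_div] at h1 h2 h3 ⊢
  rw [real_inner_comm (fderiv ℝ Φ x u) (fderiv ℝ Φ x v), real_inner_comm u v] at h1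
  linarith

/-! ### Orbit circles above a cone -/

theorem le_of_mem_aboveCCone {c : ℝ} {x : Space3} (hx : x ∈ aboveCCone c) :
    c * √(x 0 ^ 2 + x 1 ^ 2) ≤ x 2 := by
  obtain ⟨hx0, hx⟩ := hx
  set z : ℂ := ⟨x 0, x 1⟩ with hz
  have hn : ‖z‖ = √(x 0 ^ 2 + x 1 ^ 2) := by
    rw [Complex.norm_def, Complex.normSq_apply, sq, sq]
  rw [← hn]
  rcases eq_or_ne z 0 with h | h
  · have : (0 : ℝ) < x 2 := hx0
    simpa [h] using this.le
  · have hp : 0 < ‖z‖ := norm_pos_iff.2 h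
    have := hx (rotPoint ‖z‖ (c * ‖z‖) (z.arg : Real.Angle)) ⟨‖z‖, hp, _, rfl⟩
      (by simp [rotPoint, Complex.norm_mul_cos_arg, hz])
      (by simp [rotPoint, Complex.norm_mul_sin_arg, hz])
    simpa [rotPoint] using this

theorem dist_sq_eq (x y : Space3) :
    dist x y ^ 2 = (x 0 - y 0) ^ 2 + (x 1 - y 1) ^ 2 + (x 2 - y 2) ^ 2 := by
  rw [EuclideanSpace.dist_eq, Real.sq_sqrt (Finset.sum_nonneg fun _ _ => sq_nonneg _)]
  simp [Fin.sum_univ_three, Real.dist_eq, sq_abs]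

theorem dist_sq_le_of_mem_aboveCCone {c : ℝ} (hc : 0 < c) {x y : Space3}
    (hx : x ∈ aboveCCone c) (hy : y ∈ aboveCCone c) :
    dist x y ^ 2 ≤ (1 + 2 / c ^ 2) * (x 2 + y 2) ^ 2 := by
  have key : ∀ w ∈ aboveCCone c, w 0 ^ 2 + w 1 ^ 2 ≤ w 2 ^ 2 / c ^ 2 := by
    intro w hw
    have h := le_of_mem_aboveCCone hw
    rw [le_div_iff₀ (by positivity)]
    have h' := pow_le_pow_left₀ (by positivity) h 2
    rw [mul_pow, Real.sq_sqrt (by positivity)] at h'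
    linarith
  have h1 := key x hx
  have h2 := key y hy
  have hx0 : 0 < x 2 := hx.1
  have hy0 : 0 < y 2 := hy.1
  have h3 : x 2 ^ 2 / c ^ 2 + y 2 ^ 2 / c ^ 2 ≤ (x 2 + y 2) ^ 2 / c ^ 2 := by
    rw [← add_div]
    gcongr
    nlinarith
  have h4 : (1 + 2 / c ^ 2) * (x 2 + y 2) ^ 2
      = (x 2 + y 2) ^ 2 + 2 * ((x 2 + y 2) ^ 2 / c ^ 2) := by ring
  rw [dist_sq_eq, h4]
  nlinarith [sq_nonneg (x 0 + y 0), sq_nonneg (x 1 + y 1), mul_pos hx0 hy0]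

/-- Three points above a cone that are pairwise at the same hyperbolic distance are close to each
other: up to a bounded error the distance of two points above the cone is the logarithm of the
quotient of their heights, which is additive for the three ordered heights, so that a common
distance `d` satisfies `d ≥ 2 d - O(1)`. Here `δ = 4 sinh² (d / 2)`. -/
theorem equilateral_bound {c δ : ℝ} (hc : 0 < c) (hδ : 0 ≤ δ) {x y w : Space3}
    (hx : x ∈ aboveCCone c) (hy : y ∈ aboveCCone c) (hw : w ∈ aboveCCone c)
    (hxy : dist x y ^ 2 = δ * (x 2 * y 2)) (hyw : dist y w ^ 2 = δ * (y 2 * w 2))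
    (hxw : dist x w ^ 2 = δ * (x 2 * w 2)) :
    δ ^ 2 ≤ 16 * (1 + 2 / c ^ 2) ^ 2 * (δ + 2) := by
  have hN : (0 : ℝ) < 1 + 2 / c ^ 2 := by positivity
  have main : ∀ p q r : Space3, p ∈ aboveCCone c → q ∈ aboveCCone c → r ∈ aboveCCone c →
      dist p q ^ 2 = δ * (p 2 * q 2) → dist q r ^ 2 = δ * (q 2 * r 2) →
      dist p r ^ 2 = δ * (p 2 * r 2) → p 2 ≤ q 2 → q 2 ≤ r 2 →
      δ ^ 2 ≤ 16 * (1 + 2 / c ^ 2) ^ 2 * (δ + 2) := by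
    intro p q r hp hq hr hpq hqr hpr h1 h2
    have e1 := dist_sq_le_of_mem_aboveCCone hc hp hq
    have e2 := dist_sq_le_of_mem_aboveCCone hc hq hr
    have e3 := dist_sq_eq p r
    have hp0 : 0 < p 2 := hp.1
    have hq0 : 0 < q 2 := hq.1
    have hr0 : 0 < r 2 := hr.1
    set N := 1 + 2 / c ^ 2
    have f1 : δ * p 2 ≤ 4 * N * q 2 := by
      have : N * (p 2 + q 2) ^ 2 ≤ N * (2 * q 2) ^ 2 := by gcongr; linarith
      refine le_of_mul_le_mul_right ?_ hq0
      nlinarith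
    have f2 : δ * q 2 ≤ 4 * N * r 2 := by
      have : N * (q 2 + r 2) ^ 2 ≤ N * (2 * r 2) ^ 2 := by gcongr; linarith
      refine le_of_mul_le_mul_right ?_ hr0
      nlinarith
    have f3 : r 2 ≤ (δ + 2) * p 2 := by
      refine le_of_mul_le_mul_right ?_ hr0
      nlinarith [sq_nonneg (p 0 - r 0), sq_nonneg (p 1 - r 1), sq_nonneg (p 2)]
    refine le_of_mul_le_mul_right ?_ hp0
    calc δ ^ 2 * p 2 = δ * (δ * p 2) := by ring
      _ ≤ δ * (4 * N * q 2) := by gcongr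
      _ = 4 * N * (δ * q 2) := by ring
      _ ≤ 4 * N * (4 * N * r 2) := by gcongr
      _ ≤ 4 * N * (4 * N * ((δ + 2) * p 2)) := by gcongr
      _ = _ := by ring
  have hyx := hxy
  have hwy := hyw
  have hwx := hxw
  rw [dist_comm, mul_comm (x 2)] at hyx hwx
  rw [dist_comm, mul_comm (y 2)] at hwy
  rcases le_total (x 2) (y 2) with a | a <;> rcases le_total (y 2) (w 2) with b | b <;>
    rcases le_total (x 2) (w 2) with d | d
  · exact main x y w hx hy hw hxy hyw hxw a b
  · exact main x y w hx hy hw hxy hyw hxw a b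
  · exact main x w y hx hw hy hxw hwy hxy d b
  · exact main w x y hw hx hy hwx hxy hwy d a
  · exact main y x w hy hx hw hyx hxw hyw a d
  · exact main y w x hy hw hx hyw hwx hyx b d
  · exact main w y x hw hy hx hwy hyx hwx b a
  · exact main w y x hw hy hx hwy hyx hwx b a

theorem dist_sq_rotPoint (r z : ℝ) (θ η : Real.Angle) (h : (θ - η).cos = -(1 / 2)) :
    dist (rotPoint r z θ) (rotPoint r z η) ^ 2 = 3 * r ^ 2 := by
  have hc : (θ - η).cos = θ.cos * η.cos + θ.sin * η.sin := by
    induction θ using Real.Angle.induction_on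
    induction η using Real.Angle.induction_on
    rw [← Real.Angle.coe_sub]
    simp only [Real.Angle.cos_coe, Real.Angle.sin_coe, Real.cos_sub]
  have h1 := Real.Angle.cos_sq_add_sin_sq θ
  have h2 := Real.Angle.cos_sq_add_sin_sq η
  rw [dist_sq_eq]
  simp [rotPoint]
  have : (r * θ.cos - r * η.cos) ^ 2 + (r * θ.sin - r * η.sin) ^ 2 =
    r ^ 2 * ((θ.cos ^ 2 + θ.sin ^ 2) + (η.cos ^ 2 + η.sin ^ 2)
      - 2 * (θ.cos * η.cos + θ.sin * η.sin)) := by ring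
  rw [this, h1, h2, ← hc, h]
  ring

/-- An orbit circle whose image under an isometry lies above the `c`-cone stays in a tube about the
rotation axis whose size depends only on `c`, wherever the isometry moves the axis. -/
theorem exists_orbit_bound {c : ℝ} (hc : 0 < c) : ∃ C : ℝ,
    ∀ Φ : Space3 → Space3, IsHypIsometry Φ → ∀ r z : ℝ, 0 < r → 0 < z →
      (∀ θ : Real.Angle, Φ (rotPoint r z θ) ∈ aboveCCone c) → r ≤ C * z := by
  set N : ℝ := 1 + 2 / c ^ 2
  have hN : 1 ≤ N := by simp only [N]; linarith [show 0 < 2 / c ^ 2 by positivity]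
  refine ⟨48 * N ^ 2, fun Φ hΦ r z hr hz h => ?_⟩
  set δ : ℝ := 3 * r ^ 2 / (z * z)
  have hδ : 0 ≤ δ := by positivity
  have hz' : ∀ θ, 0 < rotPoint r z θ 2 := fun θ => by simpa [rotPoint] using hz
  have key : ∀ θ η : Real.Angle, (θ - η).cos = -(1 / 2) →
      dist (Φ (rotPoint r z θ)) (Φ (rotPoint r z η)) ^ 2
        = δ * (Φ (rotPoint r z θ) 2 * Φ (rotPoint r z η) 2) := by
    intro θ η hθ
    have h1 := hΦ.dist_sq_div (hz' θ) (hz' η)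
    have h2 := mul_pos (hΦ.pos (hz' θ)) (hΦ.pos (hz' η))
    rw [dist_sq_rotPoint r z θ η hθ, div_eq_iff h2.ne'] at h1
    rw [h1]
    simp [rotPoint, δ]
  have c1 : Real.cos (2 * (Real.pi / 3)) = -(1 / 2) := by
    rw [Real.cos_two_mul, Real.cos_pi_div_three]; norm_num
  have c2 : Real.cos (2 * (2 * (Real.pi / 3))) = -(1 / 2) := by
    rw [Real.cos_two_mul, c1]; norm_num
  have hb := equilateral_bound hc hδ (h ((2 * (2 * (Real.pi / 3)) : ℝ) : Real.Angle))
    (h ((2 * (Real.pi / 3) : ℝ) : Real.Angle)) (h ((0 : ℝ) : Real.Angle))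
    (key _ _ (by rw [← Real.Angle.coe_sub, Real.Angle.cos_coe, ← c1]; congr 1; ring))
    (key _ _ (by rw [← Real.Angle.coe_sub, Real.Angle.cos_coe, sub_zero, c1]))
    (key _ _ (by rw [← Real.Angle.coe_sub, Real.Angle.cos_coe, sub_zero, c2]))
  have hδ' : δ ≤ 48 * N ^ 2 := by
    by_contra! hlt
    have h16 : (0 : ℝ) < N ^ 2 := by positivity
    have : (1 : ℝ) ≤ N ^ 2 := one_le_pow₀ hN
    nlinarith
  by_contra! hlt
  have h1 : (1 : ℝ) ≤ 48 * N ^ 2 := by nlinarith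
  have h2 : 3 * r ^ 2 ≤ 48 * N ^ 2 * (z * z) := (div_le_iff₀ (by positivity)).1 hδ'
  have h3 : (48 * N ^ 2 * z) ^ 2 < r ^ 2 := by gcongr
  have h4 : 48 * N ^ 2 * (z * z) ≤ (48 * N ^ 2 * z) ^ 2 := by
    rw [mul_pow, sq z]
    exact mul_le_mul_of_nonneg_right (le_self_pow₀ h1 two_ne_zero) (by positivity)
  nlinarith [sq_nonneg r]

section Profile

variable {γ₁ γ₂ : ℝ → ℝ}

/-! ### The induced metric and the Laplace–Beltrami operator -/

/-- The Euclidean speed of the generating curve. -/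
def profileSpeed (γ₁ γ₂ : ℝ → ℝ) (t : ℝ) : ℝ :=
  √(derivWithin γ₁ (Ici 0) t ^ 2 + derivWithin γ₂ (Ici 0) t ^ 2)

/-- The conformal factor `|γ'| / γ₁` of the induced metric: with `s` a primitive of it, the metric
`(|γ'|² dt² + γ₁² dθ²) / γ₂²` is conformal to `ds² + dθ²`. -/
def confFactor (γ₁ γ₂ : ℝ → ℝ) (t : ℝ) : ℝ := profileSpeed γ₁ γ₂ t / γ₁ t

theorem IsCompleteProfile.sq_add_sq_pos (hγ : IsCompleteProfile γ₁ γ₂) {t : ℝ} (ht : 0 ≤ t) :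
    0 < derivWithin γ₁ (Ici 0) t ^ 2 + derivWithin γ₂ (Ici 0) t ^ 2 := by
  by_contra! h
  have h1 : derivWithin γ₁ (Ici 0) t = 0 := by
    nlinarith [sq_nonneg (derivWithin γ₁ (Ici 0) t), sq_nonneg (derivWithin γ₂ (Ici 0) t)]
  have h2 : derivWithin γ₂ (Ici 0) t = 0 := by
    nlinarith [sq_nonneg (derivWithin γ₁ (Ici 0) t), sq_nonneg (derivWithin γ₂ (Ici 0) t)]
  refine hγ.regular t ht ?_
  rw [h1, h2]
  ext i
  fin_cases i <;> simp [planeVec]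

theorem IsCompleteProfile.profileSpeed_pos (hγ : IsCompleteProfile γ₁ γ₂) {t : ℝ} (ht : 0 ≤ t) :
    0 < profileSpeed γ₁ γ₂ t := Real.sqrt_pos.2 (hγ.sq_add_sq_pos ht)

theorem IsCompleteProfile.confFactor_pos (hγ : IsCompleteProfile γ₁ γ₂) {t : ℝ} (ht : 0 ≤ t) :
    0 < confFactor γ₁ γ₂ t := div_pos (hγ.profileSpeed_pos ht) (hγ.pos₁ t ht)

theorem IsCompleteProfile.contDiffOn_confFactor (hγ : IsCompleteProfile γ₁ γ₂) :
    ContDiffOn ℝ 1 (confFactor γ₁ γ₂) (Ici 0) := by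
  have h1 : ContDiffOn ℝ 1 (derivWithin γ₁ (Ici 0)) (Ici 0) :=
    hγ.smooth₁.derivWithin (uniqueDiffOn_Ici 0)
      (WithTop.coe_le_coe.2 (le_top : (1 + 1 : ℕ∞) ≤ ⊤))
  have h2 : ContDiffOn ℝ 1 (derivWithin γ₂ (Ici 0)) (Ici 0) :=
    hγ.smooth₂.derivWithin (uniqueDiffOn_Ici 0)
      (WithTop.coe_le_coe.2 (le_top : (1 + 1 : ℕ∞) ≤ ⊤))
  refine ContDiffOn.div (ContDiffOn.sqrt ((h1.pow 2).add (h2.pow 2))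
    fun t ht => (hγ.sq_add_sq_pos ht).ne') (hγ.smooth₁.of_le (by exact_mod_cast le_top))
    fun t ht => (hγ.pos₁ t ht).ne'

theorem IsCompleteProfile.hasDerivAt₁ (hγ : IsCompleteProfile γ₁ γ₂) {t : ℝ} (ht : 0 < t) :
    HasDerivAt γ₁ (derivWithin γ₁ (Ici 0) t) t :=
  (((hγ.smooth₁.differentiableOn (by simp)) t ht.le).hasDerivWithinAt).hasDerivAt (Ici_mem_nhds ht)

theorem IsCompleteProfile.hasDerivAt₂ (hγ : IsCompleteProfile γ₁ γ₂) {t : ℝ} (ht : 0 < t) :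
    HasDerivAt γ₂ (derivWithin γ₂ (Ici 0) t) t :=
  (((hγ.smooth₂.differentiableOn (by simp)) t ht.le).hasDerivWithinAt).hasDerivAt (Ici_mem_nhds ht)

theorem hasDerivAt_euclidean3 {f g h : ℝ → ℝ} {f' g' h' t : ℝ} (hf : HasDerivAt f f' t)
    (hg : HasDerivAt g g' t) (hh : HasDerivAt h h' t) :
    HasDerivAt (fun s => (!₂[f s, g s, h s] : Space3)) !₂[f', g', h'] t := by
  rw [hasDerivAt_iff_hasFDerivAt, ← hasFDerivWithinAt_univ, hasFDerivWithinAt_euclidean]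
  intro i
  rw [hasFDerivWithinAt_univ]
  fin_cases i
  · exact hf.hasFDerivAt.congr_fderiv (by ext; simp)
  · exact hg.hasFDerivAt.congr_fderiv (by ext; simp)
  · exact hh.hasFDerivAt.congr_fderiv (by ext; simp)

theorem hasDerivAt_pderiv_zero {X : Type*} [NormedAddCommGroup X] [NormedSpace ℝ X] {f : ℝ × ℝ → X}
    {p : ℝ × ℝ} (hf : DifferentiableAt ℝ f p) :
    HasDerivAt (fun t => f (t, p.2)) (pderiv 0 f p) p.1 := by
  have h : HasDerivAt (fun t : ℝ => (t, p.2)) ((1 : ℝ), (0 : ℝ)) p.1 :=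
    (hasDerivAt_id p.1).prodMk (hasDerivAt_const _ _)
  exact HasFDerivAt.comp_hasDerivAt (p.1) (l := f) hf.hasFDerivAt h

theorem hasDerivAt_pderiv_one {X : Type*} [NormedAddCommGroup X] [NormedSpace ℝ X] {f : ℝ × ℝ → X}
    {p : ℝ × ℝ} (hf : DifferentiableAt ℝ f p) :
    HasDerivAt (fun θ => f (p.1, θ)) (pderiv 1 f p) p.2 := by
  have h : HasDerivAt (fun θ : ℝ => (p.1, θ)) ((0 : ℝ), (1 : ℝ)) p.2 :=
    (hasDerivAt_const _ _).prodMk (hasDerivAt_id p.2)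
  exact HasFDerivAt.comp_hasDerivAt (p.2) (l := f) hf.hasFDerivAt h

theorem isOpen_fst_pos : IsOpen {p : ℝ × ℝ | 0 < p.1} := isOpen_lt continuous_const continuous_fst

theorem inner_space3 (x y : Space3) : inner ℝ x y = x 0 * y 0 + x 1 * y 1 + x 2 * y 2 := by
  simp [PiLp.inner_apply, Fin.sum_univ_three, mul_comm]

/-- In the interior the induced metric is that of the surface of revolution itself: the isometry
disappears. -/
theorem inducedMetric_lift {F : ℝ × Real.Angle → Space3} {Φ : Space3 → Space3}
    (hΦ : IsHypIsometry Φ) (hγ : IsCompleteProfile γ₁ γ₂)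
    (hF : ∀ t, 0 ≤ t → ∀ θ : Real.Angle, F (t, θ) = Φ (rotPoint (γ₁ t) (γ₂ t) θ))
    {p : ℝ × ℝ} (hp : 0 < p.1) :
    inducedMetric (lift F) p =
      Matrix.diagonal ![(profileSpeed γ₁ γ₂ p.1 / γ₂ p.1) ^ 2, (γ₁ p.1 / γ₂ p.1) ^ 2] := by
  set R : ℝ × ℝ → Space3 :=
    fun q => !₂[γ₁ q.1 * Real.cos q.2, γ₁ q.1 * Real.sin q.2, γ₂ q.1] with hR
  have hRpos : 0 < R p 2 := by simpa [hR] using hγ.pos₂ _ hp.le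
  have hd1 := hγ.hasDerivAt₁ hp
  have hd2 := hγ.hasDerivAt₂ hp
  have hRd : DifferentiableAt ℝ R p := by
    have e1 : DifferentiableAt ℝ (fun q : ℝ × ℝ => γ₁ q.1) p :=
      hd1.differentiableAt.comp p differentiableAt_fst
    have e2 : DifferentiableAt ℝ (fun q : ℝ × ℝ => γ₂ q.1) p :=
      hd2.differentiableAt.comp p differentiableAt_fst
    rw [differentiableAt_euclidean]
    intro i
    fin_cases i
    · exact e1.mul (b := fun q : ℝ × ℝ => Real.cos q.2) (by fun_prop)
    · exact e1.mul (b := fun q : ℝ × ℝ => Real.sin q.2) (by fun_prop)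
    · exact e2
  have hev : lift F =ᶠ[𝓝 p] fun q => Φ (R q) := by
    filter_upwards [isOpen_fst_pos.mem_nhds hp] with q hq
    have hq : 0 < q.1 := hq
    simp [lift, hF q.1 hq.le, hR, rotPoint]
  have hpd : ∀ i, pderiv i (lift F) p = fderiv ℝ Φ (R p) (pderiv i R p) := by
    intro i
    unfold pderiv
    rw [hev.fderiv_eq, show (fun q => Φ (R q)) = Φ ∘ R from rfl,
      fderiv_comp p (hΦ.differentiableAt hRpos) hRd]
    rfl
  have h0 : pderiv 0 R p = !₂[derivWithin γ₁ (Ici 0) p.1 * Real.cos p.2,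
      derivWithin γ₁ (Ici 0) p.1 * Real.sin p.2, derivWithin γ₂ (Ici 0) p.1] :=
    (hasDerivAt_pderiv_zero hRd).unique
      (hasDerivAt_euclidean3 (hd1.mul_const (Real.cos p.2)) (hd1.mul_const (Real.sin p.2)) hd2)
  have h1 : pderiv 1 R p = !₂[γ₁ p.1 * -Real.sin p.2, γ₁ p.1 * Real.cos p.2, 0] :=
    (hasDerivAt_pderiv_one hRd).unique
      (hasDerivAt_euclidean3 ((Real.hasDerivAt_cos p.2).const_mul (γ₁ p.1))
        ((Real.hasDerivAt_sin p.2).const_mul (γ₁ p.1)) (hasDerivAt_const p.2 (γ₂ p.1)))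
  have hz : R p 2 = γ₂ p.1 := by simp [hR]
  have hsc := Real.sin_sq_add_cos_sq p.2
  have hv : profileSpeed γ₁ γ₂ p.1 ^ 2
      = derivWithin γ₁ (Ici 0) p.1 ^ 2 + derivWithin γ₂ (Ici 0) p.1 ^ 2 :=
    Real.sq_sqrt (hγ.sq_add_sq_pos hp.le).le
  ext i j
  rw [inducedMetric, Matrix.of_apply, hev.self_of_nhds, hpd, hpd, hΦ.hypMetric_eq hRpos,
    hypMetric, hz, inner_space3]
  fin_cases i <;> fin_cases j <;> simp [h0, h1, div_pow, hv]
  · congr 1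
    linear_combination derivWithin γ₁ (Ici 0) p.1 ^ 2 * hsc
  · left; ring
  · left; ring
  · congr 1
    linear_combination γ₁ p.1 ^ 2 * hsc

/-- Harmonicity in the coordinates `(t, θ)`, with all derivatives along coordinate lines and
known to exist: `∂ₜ (a⁻¹ ∂ₜ u) + a ∂²_θ u = 0`, where `a` is the conformal factor. -/
theorem IsBoundedHarmonic.exists_hasDerivAt {F : ℝ × Real.Angle → Space3} {Φ : Space3 → Space3}
    (hΦ : IsHypIsometry Φ) (hγ : IsCompleteProfile γ₁ γ₂)
    (hF : ∀ t, 0 ≤ t → ∀ θ : Real.Angle, F (t, θ) = Φ (rotPoint (γ₁ t) (γ₂ t) θ))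
    {u : ℝ × Real.Angle → ℝ} (hu : IsBoundedHarmonic F u) {p : ℝ × ℝ} (hp : 0 < p.1) :
    ∃ A B, HasDerivAt (fun t => (confFactor γ₁ γ₂ t)⁻¹ * pderiv 0 (lift u) (t, p.2)) A p.1 ∧
      HasDerivAt (fun θ => pderiv 1 (lift u) (p.1, θ)) B p.2 ∧
      A + confFactor γ₁ γ₂ p.1 * B = 0 := by
  set a := confFactor γ₁ γ₂ with ha
  have hU : ContDiffAt ℝ 2 (lift u) p := hu.contDiffOn.contDiffAt (isOpen_fst_pos.mem_nhds hp)
  have hdf : DifferentiableAt ℝ (fderiv ℝ (lift u)) p :=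
    (hU.fderiv_right (m := 1) (by norm_num)).differentiableAt (by norm_num)
  have hpd : ∀ i, DifferentiableAt ℝ (pderiv i (lift u)) p := fun i =>
    hdf.clm_apply (differentiableAt_const _)
  have had : DifferentiableAt ℝ a p.1 :=
    (hγ.contDiffOn_confFactor.contDiffAt (Ici_mem_nhds hp)).differentiableAt (by norm_num)
  have ha0 := hγ.confFactor_pos hp.le
  have hA : DifferentiableAt ℝ (fun q : ℝ × ℝ => a q.1) p := had.comp p differentiableAt_fst
  have hd0 : DifferentiableAt ℝ (fun q : ℝ × ℝ => (a q.1)⁻¹ * pderiv 0 (lift u) q) p :=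
    (hA.inv ha0.ne').mul (hpd 0)
  have hd1 : DifferentiableAt ℝ (fun q : ℝ × ℝ => a q.1 * pderiv 1 (lift u) q) p := hA.mul (hpd 1)
  have hflux : ∀ q : ℝ × ℝ, 0 < q.1 →
      0 < √((inducedMetric (lift F) q).det) ∧
      √((inducedMetric (lift F) q).det) * ∑ j, (inducedMetric (lift F) q)⁻¹ 0 j *
        pderiv j (lift u) q = (a q.1)⁻¹ * pderiv 0 (lift u) q ∧
      √((inducedMetric (lift F) q).det) * ∑ j, (inducedMetric (lift F) q)⁻¹ 1 j *
        pderiv j (lift u) q = a q.1 * pderiv 1 (lift u) q := by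
    intro q hq
    have hr := hγ.pos₁ _ hq.le
    have hz := hγ.pos₂ _ hq.le
    have hv := hγ.profileSpeed_pos hq.le
    have hinv : (Matrix.diagonal ![(profileSpeed γ₁ γ₂ q.1 / γ₂ q.1) ^ 2,
        (γ₁ q.1 / γ₂ q.1) ^ 2])⁻¹ = Matrix.diagonal ![((profileSpeed γ₁ γ₂ q.1 / γ₂ q.1) ^ 2)⁻¹,
        ((γ₁ q.1 / γ₂ q.1) ^ 2)⁻¹] := by
      apply Matrix.inv_eq_right_inv
      rw [Matrix.diagonal_mul_diagonal, ← Matrix.diagonal_one]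
      congr 1
      ext i
      fin_cases i
      · simp; field_simp
      · simp; field_simp
    have hdet : √((inducedMetric (lift F) q).det)
        = profileSpeed γ₁ γ₂ q.1 / γ₂ q.1 * (γ₁ q.1 / γ₂ q.1) := by
      rw [inducedMetric_lift hΦ hγ hF hq, Matrix.det_diagonal]
      simp only [Fin.prod_univ_two, Matrix.cons_val_zero, Matrix.cons_val_one]
      rw [← mul_pow, Real.sqrt_sq (by positivity)]
    rw [hdet, inducedMetric_lift hΦ hγ hF hq, hinv, ha, confFactor]
    refine ⟨by positivity, ?_, ?_⟩
    · simp [Fin.sum_univ_two]; field_simp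
    · simp [Fin.sum_univ_two]; field_simp
  have hh := hu.harmonic p hp
  rw [laplaceBeltrami, Fin.sum_univ_two,
    mul_eq_zero_iff_left (inv_ne_zero (hflux p hp).1.ne')] at hh
  have hev := isOpen_fst_pos.mem_nhds hp
  have g0 : pderiv 0 (fun q => √((inducedMetric (lift F) q).det) * ∑ j,
      (inducedMetric (lift F) q)⁻¹ 0 j * pderiv j (lift u) q) p
      = pderiv 0 (fun q : ℝ × ℝ => (a q.1)⁻¹ * pderiv 0 (lift u) q) p :=
    congrArg (fun L : ℝ × ℝ →L[ℝ] ℝ => L (coordVec 0))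
      (EventuallyEq.fderiv_eq (mem_of_superset hev fun q hq => (hflux q hq).2.1))
  have g1 : pderiv 1 (fun q => √((inducedMetric (lift F) q).det) * ∑ j,
      (inducedMetric (lift F) q)⁻¹ 1 j * pderiv j (lift u) q) p
      = pderiv 1 (fun q : ℝ × ℝ => a q.1 * pderiv 1 (lift u) q) p :=
    congrArg (fun L : ℝ × ℝ →L[ℝ] ℝ => L (coordVec 1))
      (EventuallyEq.fderiv_eq (mem_of_superset hev fun q hq => (hflux q hq).2.2))
  rw [g0, g1] at hh
  have hB := hasDerivAt_pderiv_one (hpd 1)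
  refine ⟨_, _, hasDerivAt_pderiv_zero hd0, hB, ?_⟩
  rw [← hh, (hasDerivAt_pderiv_one hd1).unique (hB.const_mul (a p.1))]

/-! ### The isothermal coordinate -/

/-- The isothermal coordinate `s(t) = ∫₀ᵗ |γ'| / γ₁`. -/
def isoCoord (γ₁ γ₂ : ℝ → ℝ) (t : ℝ) : ℝ := ∫ τ in (0 : ℝ)..t, confFactor γ₁ γ₂ τ

theorem IsCompleteProfile.intervalIntegrable (hγ : IsCompleteProfile γ₁ γ₂) {s t : ℝ}
    (hs : 0 ≤ s) (ht : 0 ≤ t) : IntervalIntegrable (confFactor γ₁ γ₂) volume s t :=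
  (hγ.contDiffOn_confFactor.continuousOn.mono
    fun _ hx => (le_min hs ht).trans hx.1).intervalIntegrable

theorem IsCompleteProfile.hasDerivAt_isoCoord (hγ : IsCompleteProfile γ₁ γ₂) {t : ℝ}
    (ht : 0 < t) : HasDerivAt (isoCoord γ₁ γ₂) (confFactor γ₁ γ₂ t) t :=
  intervalIntegral.integral_hasDerivAt_right (hγ.intervalIntegrable le_rfl ht.le)
    (ContinuousOn.stronglyMeasurableAtFilter_nhdsWithin
      hγ.contDiffOn_confFactor.continuousOn measurableSet_Ici t |>.filter_mono
        (by rw [nhdsWithin_eq_nhds.2 (Ici_mem_nhds ht)]))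
    (hγ.contDiffOn_confFactor.continuousOn.continuousAt (Ici_mem_nhds ht))

theorem isoCoord_zero : isoCoord γ₁ γ₂ 0 = 0 := intervalIntegral.integral_same

theorem IsCompleteProfile.isoCoord_mono (hγ : IsCompleteProfile γ₁ γ₂) :
    MonotoneOn (isoCoord γ₁ γ₂) (Ici 0) := by
  intro s hs t ht hst
  have h := intervalIntegral.integral_add_adjacent_intervals
    (hγ.intervalIntegrable le_rfl hs) (hγ.intervalIntegrable hs ht)
  have h' : 0 ≤ ∫ τ in s..t, confFactor γ₁ γ₂ τ :=
    intervalIntegral.integral_nonneg hst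
      fun x hx => (hγ.confFactor_pos ((mem_Ici.1 hs).trans hx.1)).le
  simp only [isoCoord]
  linarith

theorem IsCompleteProfile.isoCoord_nonneg (hγ : IsCompleteProfile γ₁ γ₂) {t : ℝ} (ht : 0 ≤ t) :
    0 ≤ isoCoord γ₁ γ₂ t := by
  simpa [isoCoord_zero] using hγ.isoCoord_mono self_mem_Ici ht ht

theorem IsCompleteProfile.continuousOn_isoCoord (hγ : IsCompleteProfile γ₁ γ₂) :
    ContinuousOn (isoCoord γ₁ γ₂) (Ici 0) := by
  intro t ht
  have ht : 0 ≤ t := ht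
  have h := intervalIntegral.continuousOn_primitive_interval'
    (hγ.intervalIntegrable le_rfl (by linarith : 0 ≤ t + 1)) left_mem_uIcc
  rw [uIcc_of_le (by linarith)] at h
  refine (h t ⟨ht, by linarith⟩).mono_of_mem_nhdsWithin ?_
  rw [← Ici_inter_Iic]
  exact inter_mem_nhdsWithin _ (Iic_mem_nhds (by linarith))

/-- Infinite hyperbolic length, together with a bound on `γ₁ / γ₂`, makes the isothermal coordinate
unbounded, since the hyperbolic arc length is `(γ₁ / γ₂) ds`. -/
theorem IsCompleteProfile.exists_lt_isoCoord (hγ : IsCompleteProfile γ₁ γ₂) {C : ℝ}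
    (hC : ∀ t, 0 ≤ t → γ₁ t ≤ C * γ₂ t) (M : ℝ) : ∃ t, 0 ≤ t ∧ M < isoCoord γ₁ γ₂ t := by
  by_contra! hM
  have hI : IntegrableOn (confFactor γ₁ γ₂) (Ioi 0) := by
    refine integrableOn_Ioi_of_intervalIntegral_norm_bounded M 0 (l := atTop) (b := id)
      (fun t => ?_) tendsto_id ?_
    · rcases le_total 0 t with h | h
      · exact (intervalIntegrable_iff_integrableOn_Ioc_of_le h).1 (hγ.intervalIntegrable le_rfl h)
      · simp [Ioc_eq_empty (not_lt.2 h)]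
    · filter_upwards [eventually_ge_atTop 0] with t ht
      refine le_trans (le_of_eq ?_) (hM t ht)
      refine intervalIntegral.integral_congr fun x hx => ?_
      rw [id, uIcc_of_le ht] at hx
      exact Real.norm_of_nonneg (hγ.confFactor_pos hx.1).le
  have hI' : IntegrableOn (fun t => C * confFactor γ₁ γ₂ t) (Ici 0) :=
    ((integrableOn_Ici_iff_integrableOn_Ioi).2 hI).const_mul C
  refine (hI'.lintegral_lt_top.trans_le' ?_).ne hγ.length_eq_top
  refine setLIntegral_mono' measurableSet_Ici fun t ht => ENNReal.ofReal_le_ofReal ?_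
  have ht : 0 ≤ t := ht
  have hr := hγ.pos₁ t ht
  have hz := hγ.pos₂ t ht
  have e : hypMetric (planeVec (γ₁ t) (γ₂ t))
      (planeVec (derivWithin γ₁ (Ici 0) t) (derivWithin γ₂ (Ici 0) t))
      (planeVec (derivWithin γ₁ (Ici 0) t) (derivWithin γ₂ (Ici 0) t))
      = (derivWithin γ₁ (Ici 0) t ^ 2 + derivWithin γ₂ (Ici 0) t ^ 2) / γ₂ t ^ 2 := by
    rw [hypMetric, inner_space3]
    simp [planeVec, sq]
  rw [e, Real.sqrt_div (hγ.sq_add_sq_pos ht).le, Real.sqrt_sq hz.le, confFactor, mul_div_assoc']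
  change profileSpeed γ₁ γ₂ t / γ₂ t ≤ _
  rw [div_le_div_iff₀ hz hr]
  nlinarith [mul_le_mul_of_nonneg_left (hC t ht) (hγ.profileSpeed_pos ht).le]

/-! ### The maximum principle -/

/-- A second derivative test: if `f' = b g` with `b > 0`, and `g` vanishes at `x` with positive
derivative, then `f` increases strictly to the right of `x`. -/
theorem not_isLocalMax_of_deriv_pos {f g b : ℝ → ℝ} {x g' : ℝ}
    (hf : ∀ᶠ y in 𝓝 x, HasDerivAt f (b y * g y) y) (hb : ∀ᶠ y in 𝓝 x, 0 < b y)
    (hg : HasDerivAt g g' x) (hg' : 0 < g') : ¬ IsLocalMax f x := by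
  intro hmax
  have h0 : g x = 0 := by
    have := hmax.hasDerivAt_eq_zero hf.self_of_nhds
    exact (mul_eq_zero.1 this).resolve_left hb.self_of_nhds.ne'
  have hpos : ∀ᶠ y in 𝓝[>] x, 0 < g y := by
    have := (hasDerivAt_iff_tendsto_slope.1 hg).eventually (lt_mem_nhds hg')
    filter_upwards [this.filter_mono (nhdsWithin_mono x fun y hy => ne_of_gt hy),
      self_mem_nhdsWithin] with y hy hxy
    rw [slope_def_field, h0, sub_zero] at hy
    exact (div_pos_iff_of_pos_right (sub_pos.2 hxy)).1 hy
  have hall : ∀ᶠ y in 𝓝[>] x, 0 < g y ∧ HasDerivAt f (b y * g y) y ∧ 0 < b y ∧ f y ≤ f x :=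
    hpos.and ((hf.filter_mono nhdsWithin_le_nhds).and
      ((hb.filter_mono nhdsWithin_le_nhds).and (hmax.filter_mono nhdsWithin_le_nhds)))
  obtain ⟨w, hw, hsub⟩ := mem_nhdsGT_iff_exists_Ioc_subset.1 hall
  have hw : x < w := hw
  have hmono : StrictMonoOn f (Icc x w) := by
    refine strictMonoOn_of_deriv_pos (convex_Icc x w) ?_ ?_
    · intro y hy
      rcases hy.1.eq_or_lt with rfl | h
      · exact hf.self_of_nhds.continuousAt.continuousWithinAt
      · exact (hsub ⟨h, hy.2⟩).2.1.continuousAt.continuousWithinAt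
    · intro y hy
      rw [interior_Icc] at hy
      obtain ⟨h1, h2, h3, -⟩ := hsub ⟨hy.1, hy.2.le⟩
      rw [h2.deriv]
      exact mul_pos h3 h1
  exact ((hsub ⟨hw, le_rfl⟩).2.2.2).not_gt
    (hmono (left_mem_Icc.2 hw.le) (right_mem_Icc.2 hw.le) hw)

/-- The comparison of `u - v` with the barrier `ε log (1 + s)`, which is strictly superharmonic, so
that the second derivative test at a maximum suffices and no strong maximum principle is needed. -/
theorem IsCompleteProfile.sub_le_log {F : ℝ × Real.Angle → Space3} {Φ : Space3 → Space3}
    (hΦ : IsHypIsometry Φ) (hγ : IsCompleteProfile γ₁ γ₂)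
    (hF : ∀ t, 0 ≤ t → ∀ θ : Real.Angle, F (t, θ) = Φ (rotPoint (γ₁ t) (γ₂ t) θ))
    (hs : ∀ M : ℝ, ∃ t, 0 ≤ t ∧ M < isoCoord γ₁ γ₂ t)
    {u v : ℝ × Real.Angle → ℝ} (hu : IsBoundedHarmonic F u) (hv : IsBoundedHarmonic F v)
    (huv : ∀ θ : Real.Angle, u (0, θ) = v (0, θ)) {ε : ℝ} (hε : 0 < ε)
    {t₁ : ℝ} (ht₁ : 0 ≤ t₁) (θ₁ : Real.Angle) :
    u (t₁, θ₁) - v (t₁, θ₁) ≤ ε * Real.log (1 + isoCoord γ₁ γ₂ t₁) := by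
  by_contra! hlt
  obtain ⟨Mu, hMu⟩ := hu.bounded
  obtain ⟨Mv, hMv⟩ := hv.bounded
  set s := isoCoord γ₁ γ₂ with hs_def
  set a := confFactor γ₁ γ₂ with ha_def
  set φ : ℝ × ℝ → ℝ := fun p => lift u p - lift v p - ε * Real.log (1 + s p.1) with hφ
  obtain ⟨T, hT0, hT⟩ := hs (Real.exp ((Mu + Mv) / ε))
  have hs0 : ∀ t, 0 ≤ t → 0 ≤ s t := fun t ht => hγ.isoCoord_nonneg ht
  -- Beyond `T` the barrier exceeds the bounds of `u` and `v`.
  have hfar : ∀ p : ℝ × ℝ, T ≤ p.1 → φ p ≤ 0 := by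
    intro p hp
    have hp0 : 0 ≤ p.1 := hT0.trans hp
    have h1 : Real.exp ((Mu + Mv) / ε) ≤ 1 + s p.1 := by
      have := hγ.isoCoord_mono hT0 hp0 hp
      linarith
    have h2 : (Mu + Mv) / ε ≤ Real.log (1 + s p.1) :=
      (Real.le_log_iff_exp_le (by linarith [hs0 _ hp0])).2 h1
    rw [div_le_iff₀ hε] at h2
    have h3 := abs_le.1 (hMu (p.1, p.2) hp0)
    have h4 := abs_le.1 (hMv (p.1, p.2) hp0)
    simp only [hφ, lift]
    linarith
  have hcont : ContinuousOn φ {p : ℝ × ℝ | 0 ≤ p.1} := by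
    have hm : Continuous fun p : ℝ × ℝ => (p.1, (p.2 : Real.Angle)) :=
      continuous_fst.prodMk (Real.Angle.continuous_coe.comp continuous_snd)
    have hlog : ContinuousOn (fun p : ℝ × ℝ => Real.log (1 + s p.1)) {p : ℝ × ℝ | 0 ≤ p.1} :=
      (continuousOn_const.add (hγ.continuousOn_isoCoord.comp continuous_fst.continuousOn
        fun p hp => hp)).log fun p hp => (add_pos_of_pos_of_nonneg one_pos (hs0 p.1 hp)).ne'
    exact ((hu.continuousOn.comp hm.continuousOn fun p hp => hp).sub
      (hv.continuousOn.comp hm.continuousOn fun p hp => hp)).sub (continuousOn_const.mul hlog)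
  have hpos₁ : 0 < φ (t₁, θ₁.toReal) := by
    simpa [hφ, lift] using hlt
  have ht₁T : t₁ < T := by
    by_contra! h
    exact (hfar (t₁, θ₁.toReal) h).not_gt hpos₁
  obtain ⟨p, hpK, hpmax⟩ := (isCompact_Icc.prod isCompact_Icc :
      IsCompact (Icc (0 : ℝ) T ×ˢ Icc (-Real.pi) Real.pi)).exists_isMaxOn
    ⟨(t₁, θ₁.toReal), ⟨ht₁, ht₁T.le⟩, θ₁.neg_pi_lt_toReal.le, θ₁.toReal_le_pi⟩
    (hcont.mono fun p hp => hp.1.1)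
  have hpp : 0 < φ p := hpos₁.trans_le
    (hpmax ⟨⟨ht₁, ht₁T.le⟩, θ₁.neg_pi_lt_toReal.le, θ₁.toReal_le_pi⟩)
  -- By periodicity and the choice of `T`, the maximum on the compact rectangle is global.
  have hglob : ∀ q : ℝ × ℝ, 0 ≤ q.1 → φ q ≤ φ p := by
    intro q hq
    rcases le_total T q.1 with h | h
    · exact (hfar q h).trans hpp.le
    · have hq' : φ q = φ (q.1, (q.2 : Real.Angle).toReal) := by simp [hφ, lift]
      rw [hq']
      exact hpmax ⟨⟨hq, h⟩, (Real.Angle.neg_pi_lt_toReal (q.2 : Real.Angle)).le,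
        Real.Angle.toReal_le_pi (q.2 : Real.Angle)⟩
  have hp0 : 0 < p.1 := by
    rcases hpK.1.1.eq_or_lt with h | h
    · exfalso
      have hp : p = (0, p.2) := Prod.ext h.symm rfl
      rw [hp] at hpp
      simp [hφ, lift, huv, hs_def, isoCoord_zero] at hpp
    · exact h
  obtain ⟨Au, Bu, hAu, hBu, hu0⟩ := hu.exists_hasDerivAt hΦ hγ hF hp0
  obtain ⟨Av, Bv, hAv, hBv, hv0⟩ := hv.exists_hasDerivAt hΦ hγ hF hp0
  have hap : 0 < a p.1 := hγ.confFactor_pos hp0.le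
  have hdiff : ∀ {w : ℝ × Real.Angle → ℝ}, IsBoundedHarmonic F w → ∀ q : ℝ × ℝ, 0 < q.1 →
      DifferentiableAt ℝ (lift w) q := fun hw q hq =>
    (hw.contDiffOn.contDiffAt (isOpen_fst_pos.mem_nhds hq)).differentiableAt (by norm_num)
  have hspos : 0 < 1 + s p.1 := by linarith [hs0 p.1 hp0.le]
  -- In the variable `t` the flux `a⁻¹ ∂ₜ φ` has derivative `Au - Av + ε a / (1 + s)²`.
  have hT' : ¬ 0 < Au - Av + ε * (a p.1 / (1 + s p.1) ^ 2) := by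
    intro hpos
    refine not_isLocalMax_of_deriv_pos (f := fun t => φ (t, p.2)) (x := p.1) (b := a)
      (g := fun t => (a t)⁻¹ * pderiv 0 (lift u) (t, p.2) - (a t)⁻¹ * pderiv 0 (lift v) (t, p.2)
        - ε * (1 + s t)⁻¹) (g' := Au - Av + ε * (a p.1 / (1 + s p.1) ^ 2)) ?_ ?_ ?_ hpos ?_
    · filter_upwards [lt_mem_nhds hp0] with t ht
      have hat : 0 < a t := hγ.confFactor_pos ht.le
      have hst : 0 < 1 + s t := by linarith [hs0 t ht.le]
      have h1 := hasDerivAt_pderiv_zero (hdiff hu (t, p.2) ht)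
      have h2 := hasDerivAt_pderiv_zero (hdiff hv (t, p.2) ht)
      have h3 := (((hγ.hasDerivAt_isoCoord ht).const_add 1).log hst.ne').const_mul ε
      refine ((h1.sub h2).sub h3).congr_deriv ?_
      rw [← hs_def, ← ha_def]
      field_simp
    · filter_upwards [lt_mem_nhds hp0] with t ht using hγ.confFactor_pos ht.le
    · have h3 := (((hγ.hasDerivAt_isoCoord hp0).const_add 1).inv hspos.ne').const_mul ε
      refine ((hAu.sub hAv).sub h3).congr_deriv ?_
      rw [← hs_def, ← ha_def]
      ring
    · filter_upwards [lt_mem_nhds hp0] with t ht using hglob (t, p.2) ht.le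
  have hΘ : ¬ 0 < Bu - Bv := by
    intro hpos
    refine not_isLocalMax_of_deriv_pos (f := fun θ => φ (p.1, θ)) (x := p.2) (b := fun _ => 1)
      (g := fun θ => pderiv 1 (lift u) (p.1, θ) - pderiv 1 (lift v) (p.1, θ))
      (g' := Bu - Bv) ?_ (.of_forall fun _ => one_pos) (hBu.sub hBv) hpos
      (.of_forall fun θ => hglob (p.1, θ) hp0.le)
    refine .of_forall fun θ => ?_
    have h1 := hasDerivAt_pderiv_one (hdiff hu (p.1, θ) hp0)
    have h2 := hasDerivAt_pderiv_one (hdiff hv (p.1, θ) hp0)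
    exact ((h1.sub h2).sub_const (ε * Real.log (1 + s p.1))).congr_deriv (one_mul _).symm
  have h1 : 0 < ε * (a p.1 / (1 + s p.1) ^ 2) := by positivity
  have h2 : a p.1 * (Bu - Bv) ≤ 0 := mul_nonpos_of_nonneg_of_nonpos hap.le (not_lt.1 hΘ)
  rw [← ha_def] at hu0 hv0
  linarith

end Profile

end HypRev

end

theorem theoremB (F : ℝ × Real.Angle → HypRev.Space3)
    (hF : HypRev.IsCompleteEndOfRevolution F)
    (c : ℝ) (hc : 0 < c)
    (hcone : F '' HypRev.halfCylinder ⊆ HypRev.aboveCCone c) :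
    HypRev.IsParabolicEnd F := by
  obtain ⟨Φ, γ₁, γ₂, hΦ, hγ, hF⟩ := hF
  obtain ⟨C, hC⟩ := HypRev.exists_orbit_bound hc
  have hs := hγ.exists_lt_isoCoord fun t ht => hC Φ hΦ _ _ (hγ.pos₁ t ht) (hγ.pos₂ t ht)
    fun θ => hF t ht θ ▸ hcone ⟨(t, θ), ht, rfl⟩
  have hle : ∀ u v : ℝ × Real.Angle → ℝ, HypRev.IsBoundedHarmonic F u →
      HypRev.IsBoundedHarmonic F v → (∀ θ : Real.Angle, u (0, θ) = v (0, θ)) →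
      ∀ p ∈ HypRev.halfCylinder, u p ≤ v p := by
    rintro u v hu hv huv ⟨t, θ⟩ ht
    have hlim : Filter.Tendsto (fun ε : ℝ => ε * Real.log (1 + HypRev.isoCoord γ₁ γ₂ t))
        (nhdsWithin 0 (Ioi 0)) (nhds 0) := by
      have : Continuous fun ε : ℝ => ε * Real.log (1 + HypRev.isoCoord γ₁ γ₂ t) := by fun_prop
      simpa using (this.tendsto 0).mono_left nhdsWithin_le_nhds
    refine sub_nonpos.1 (ge_of_tendsto hlim ?_)
    filter_upwards [self_mem_nhdsWithin] with ε hε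
    exact HypRev.IsCompleteProfile.sub_le_log hΦ hγ hF hs hu hv huv hε ht θ
  exact fun u v hu hv huv p hp =>
    (hle u v hu hv huv p hp).antisymm (hle v u hv hu (fun θ => (huv θ).symm) p hp)
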